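/- **Setting.** Let $\mathcal I$ be the set of closed bounded intervals $Q=[\underline q,\overline q]$ of $\mathbb R$, $\underline q\le\overline q$, with centre $q^c=\frac{\underline q+\overline q}{2}$ and width $q^w=\frac{\overline q-\underline q}{2}$; write $Q\prec_{CW}R$ if $q^c<r^c$ and $q^w<r^w$. Let $F_k:\mathbb R^n\to\mathcal I$, $k\in K=\{1,\dots,m\}$, $F_k(u)=[\underline F_k(u),\overline F_k(u)]$, with centre function $F_k^c$ and width function $F_k^w$, and $g_j:\mathbb R^n\to\mathbb R$, $j\in J=\{1,\dots,p\}$, be locally Lipschitz. For $F_k$ this means that every point of $\mathbb R^n$ has a neighbourhood $U$ and a constant $L>0$ with $\max\{|\underline F_k(u_1)-\underline F_k(u_2)|,|\overline F_k(u_1)-\overline F_k(u_2)|\}\le L\|u_1-u_2\|$ for all $u_1,u_2\in U$. Put $S=\{u\in\mathbb R^n: g_j(u)\le 0\ \forall j\in J\}$ and $I(u)=\{j\in J: g_j(u)=0\}$. For a locally Lipschitz $\psi:\mathbb R^n\to\mathbb R$ let $\psi^0(z;w)=\limsup_{u\to z,\,t\to0^+}\frac{\psi(u+tw)-\psi(u)}{t}$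 and let $\partial^0\psi(z)=\{z^*\in\mathbb R^n:\langle z^*,w\rangle\le\psi^0(z;w)\ \forall w\in\mathbb R^n\}$ be its Clarke gradient. Let $\partial^0F_k(u)$ be the convex hull of $\partial^0F_k^c(u)\cup\partial^0F_k^w(u)$. Sums and multiples of sets are taken in the sense of Minkowski. A point $\bar u\in S$ is a *weak minimal solution* if there is no $z\in S$ with $F_k(z)\prec_{CW}F_k(\bar u)$ for all $k\in K$. The *basic constraint qualification* (BCQ) holds at $\bar u\in S$ if there is no $\mu\in\mathbb R^p_+\setminus\{0\}$ with $\mu_j=0$ for all $j\notin I(\bar u)$ and $0\in\sum_{j\in J}\mu_j\,\partial^0g_j(\bar u)$. **Theorem 4.2.** Let $\bar u$ be a weak minimal solution at which BCQ holds. Then there exist $\lambda\in\mathbb R^m_+$ with $\sum_{k\in K}\lambda_k=1$ and $\mu\in\mathbb R^p_+$ such that $$0\in\sum_{k\in K}\lambda_k\,\partial^0F_k(\bar u)+\sum_{j\in I(\bar u)}\mu_j\,\partial^0g_j(\bar u)\qquad\text{and}\qquad \mu_j\,g_j(\bar u)=0\quad\text{for all } j\in J.$$ -/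

import Mathlib

open Filter Topology
open scoped Pointwise RealInnerProductSpace

noncomputable section

namespace IntervalOpt

/-! ### Closed bounded real intervals

`NonemptyInterval ℝ` is the type of pairs `Q = [Q.fst, Q.snd]` with `Q.fst ≤ Q.snd`. -/

/-- The centre of the interval `Q`. -/
def center (Q : NonemptyInterval ℝ) : ℝ := (Q.fst + Q.snd) / 2

/-- The width (half of the length) of the interval `Q`. -/
def width (Q : NonemptyInterval ℝ) : ℝ := (Q.snd - Q.fst) / 2

/-- The strict centre-width order on intervals. -/
def StrictCW (Q R : NonemptyInterval ℝ) : Prop := center Q < center R ∧ width Q < width R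

/-- The norm of an interval. -/
def intervalNorm (Q : NonemptyInterval ℝ) : ℝ := max |Q.fst| |Q.snd|

/-- The generalized Hukuhara difference of two intervals, by its explicit formula;
`gHDiff_eq_iff` below is the defining property. -/
def gHDiff (Q R : NonemptyInterval ℝ) : NonemptyInterval ℝ :=
  ⟨(min (Q.fst - R.fst) (Q.snd - R.snd), max (Q.fst - R.fst) (Q.snd - R.snd)), min_le_max⟩

theorem gHDiff_eq_iff (Q R P : NonemptyInterval ℝ) :
    gHDiff Q R = P ↔ Q = R + P ∨ R = Q - P := by
  obtain ⟨⟨q₁, q₂⟩, hq⟩ := Q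
  obtain ⟨⟨r₁, r₂⟩, hr⟩ := R
  obtain ⟨⟨p₁, p₂⟩, hp⟩ := P
  simp only [gHDiff, NonemptyInterval.ext_iff, Prod.ext_iff, NonemptyInterval.fst_add,
    NonemptyInterval.snd_add, NonemptyInterval.fst_sub, NonemptyInterval.snd_sub] at *
  constructor
  · rintro ⟨h₁, h₂⟩
    rcases le_total (q₁ - r₁) (q₂ - r₂) with h | h
    · rw [min_eq_left h] at h₁
      rw [max_eq_right h] at h₂
      left
      constructor <;> linarith
    · rw [min_eq_right h] at h₁
      rw [max_eq_left h] at h₂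
      right
      constructor <;> linarith
  · rintro (⟨h₁, h₂⟩ | ⟨h₁, h₂⟩)
    · have h : q₁ - r₁ ≤ q₂ - r₂ := by linarith
      rw [min_eq_left h, max_eq_right h]
      constructor <;> linarith
    · have h : q₂ - r₂ ≤ q₁ - r₁ := by linarith
      rw [min_eq_right h, max_eq_left h]
      constructor <;> linarith

/-- Local Lipschitz continuity of an interval-valued function on `ℝⁿ`. -/
def IntervalLocallyLipschitz {n : ℕ}
    (f : EuclideanSpace ℝ (Fin n) → NonemptyInterval ℝ) : Prop :=
  ∀ u₀, ∃ U ∈ 𝓝 u₀, ∃ L : ℝ, 0 < L ∧ ∀ u₁ ∈ U, ∀ u₂ ∈ U,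
    intervalNorm (gHDiff (f u₁) (f u₂)) ≤ L * ‖u₁ - u₂‖

/-! ### Clarke's generalized gradient -/

/-- Clarke's directional derivative of `ψ` at `z` in the direction `w`, the upper limit of
`(ψ (u + t w) - ψ u) / t` as `u → z` and `t → 0⁺`. It is used for locally Lipschitz `ψ` only,
where the quotient is bounded near the limit, so that the real `limsup` is the true one. -/
def clarkeDeriv {n : ℕ} (ψ : EuclideanSpace ℝ (Fin n) → ℝ) (z w : EuclideanSpace ℝ (Fin n)) : ℝ :=
  limsup (fun q : EuclideanSpace ℝ (Fin n) × ℝ => (ψ (q.1 + q.2 • w) - ψ q.1) / q.2)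
    (𝓝 z ×ˢ 𝓝[>] (0 : ℝ))

/-- Clarke's generalized gradient of `ψ` at `z`. -/
def clarkeGradient {n : ℕ} (ψ : EuclideanSpace ℝ (Fin n) → ℝ) (z : EuclideanSpace ℝ (Fin n)) :
    Set (EuclideanSpace ℝ (Fin n)) :=
  {v | ∀ w, ⟪v, w⟫ ≤ clarkeDeriv ψ z w}

/-- The weakly generalized gradient of an interval-valued function: the convex hull of the union
of the Clarke gradients of its centre function and of its width function. -/
def intervalGradient {n : ℕ} (f : EuclideanSpace ℝ (Fin n) → NonemptyInterval ℝ)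
    (u : EuclideanSpace ℝ (Fin n)) : Set (EuclideanSpace ℝ (Fin n)) :=
  convexHull ℝ (clarkeGradient (fun x => center (f x)) u ∪ clarkeGradient (fun x => width (f x)) u)

/-! ### The multiobjective interval-valued problem -/

/-- The feasible set of the constraints `g j u ≤ 0`. -/
def feasibleSet {n p : ℕ} (g : Fin p → EuclideanSpace ℝ (Fin n) → ℝ) :
    Set (EuclideanSpace ℝ (Fin n)) :=
  {u | ∀ j, g j u ≤ 0}

/-- `u` is a (global) weak minimal solution of `Min (F 1, …, F m)` over `S`. -/
def IsWeakMinimal {n m : ℕ} (F : Fin m → EuclideanSpace ℝ (Fin n) → NonemptyInterval ℝ)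
    (S : Set (EuclideanSpace ℝ (Fin n))) (u : EuclideanSpace ℝ (Fin n)) : Prop :=
  u ∈ S ∧ ¬ ∃ z ∈ S, ∀ k, StrictCW (F k z) (F k u)

/-- The indices of the constraints that are active at `u`. -/
def activeSet {n p : ℕ} (g : Fin p → EuclideanSpace ℝ (Fin n) → ℝ)
    (u : EuclideanSpace ℝ (Fin n)) : Finset (Fin p) :=
  Finset.univ.filter (fun j => g j u = 0)

/-- The basic constraint qualification at `u`. The sum is a Minkowski sum of dilated sets. -/
def BCQ {n p : ℕ} (g : Fin p → EuclideanSpace ℝ (Fin n) → ℝ)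
    (u : EuclideanSpace ℝ (Fin n)) : Prop :=
  ¬ ∃ μ : Fin p → ℝ, μ ≠ 0 ∧ (∀ j, 0 ≤ μ j) ∧ (∀ j, j ∉ activeSet g u → μ j = 0) ∧
    (0 : EuclideanSpace ℝ (Fin n)) ∈ ∑ j, μ j • clarkeGradient (g j) u

end IntervalOpt

end

/-! Subtract from every centre and width function its value at `u` and adjoin the constraints. All
these functions are nonpositive at `u`, and weak minimality says that no point makes them all
negative; hence their maximum is minimal at `u`, with value zero. A negative Clarke derivative
forces descent, and functions negative at `u` stay negative nearby, so no direction makes all active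
Clarke derivatives negative. These derivatives are sublinear, so Hahn–Banach, used twice, turns this
into a vanishing convex combination of subgradients: first separation yields weights
(`exists_convex_combination_nonneg`), then extension from the diagonal yields subgradients
(`exists_linearMap_le_sum_smul_eq_zero`). BCQ forbids all the weight from lying on the constraints,
so one may divide by the total objective weight. Convexity of the interval gradient merges the
centre and width weights of each objective. -/

namespace IntervalOpt

/-! ### A theorem of the alternative for sublinear functionals -/

section Sublinear

variable {V : Type*} [AddCommGroup V] [Module ℝ V]

/-- Positive homogeneity (for positive factors) and subadditivity. -/
structure IsSublinear (N : V → ℝ) : Prop where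
  smul : ∀ c : ℝ, 0 < c → ∀ x, N (c • x) = c * N x
  add_le : ∀ x y, N (x + y) ≤ N x + N y

theorem IsSublinear.map_zero {N : V → ℝ} (hN : IsSublinear N) : N 0 = 0 := by
  have h := hN.smul 2 two_pos 0
  rw [smul_zero] at h
  linarith

theorem IsSublinear.exists_linearMap_le {N : V → ℝ} (hN : IsSublinear N) :
    ∃ f : V →ₗ[ℝ] ℝ, ∀ x, f x ≤ N x := by
  obtain ⟨f, -, hf⟩ := exists_extension_of_le_sublinear (⊥ : V →ₗ.[ℝ] ℝ) N hN.smul hN.add_le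
    (fun x => by
      have hx : (x : V) = 0 := (Submodule.mem_bot ℝ).1 x.2
      have hx' : x = 0 := Subtype.ext hx
      rw [hx, hN.map_zero, hx', LinearPMap.map_zero])
  exact ⟨f, hf⟩

variable {ι : Type*} [Fintype ι]

/-- If the maximum of finitely many sublinear functionals is nowhere negative, then so is some
convex combination of them. -/
theorem exists_convex_combination_nonneg [Nonempty ι] {N : ι → V → ℝ}
    (hN : ∀ i, IsSublinear (N i)) (h : ∀ w, ∃ i, 0 ≤ N i w) :
    ∃ c : ι → ℝ, (∀ i, 0 ≤ c i) ∧ ∑ i, c i = 1 ∧ ∀ w, 0 ≤ ∑ i, c i * N i w := by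
  classical
  -- The vectors strictly above some value vector `(N i w)`: sublinearity makes this set convex, and
  -- `h` keeps 0 out of it. A separating functional has the weights as coordinates, up to scaling.
  let C : Set (ι → ℝ) := ⋃ w : V, Set.univ.pi fun i => Set.Ioi (N i w)
  have mem_C : ∀ y, y ∈ C ↔ ∃ w, ∀ i, N i w < y i := by simp [C]
  have hopen : IsOpen C :=
    isOpen_iUnion fun w => isOpen_set_pi Set.finite_univ fun i _ => isOpen_Ioi
  have hconv : Convex ℝ C := by
    rw [convex_iff_forall_pos]
    intro x hx y hy a b ha hb _
    obtain ⟨v, hv⟩ := (mem_C x).1 hx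
    obtain ⟨w, hw⟩ := (mem_C y).1 hy
    refine (mem_C _).2 ⟨a • v + b • w, fun i => ?_⟩
    calc N i (a • v + b • w) ≤ N i (a • v) + N i (b • w) := (hN i).add_le _ _
      _ = a * N i v + b * N i w := by rw [(hN i).smul a ha, (hN i).smul b hb]
      _ < a * x i + b * y i := by gcongr <;> simp_all
      _ = _ := by simp
  have hzero : (0 : ι → ℝ) ∉ C := by
    rw [mem_C]
    rintro ⟨w, hw⟩
    obtain ⟨i, hi⟩ := h w
    exact (hw i).not_ge hi
  obtain ⟨f, hf⟩ := geometric_hahn_banach_point_open hconv hopen hzero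
  rw [map_zero] at hf
  let c : ι → ℝ := fun i => f (Pi.single i 1)
  have f_eq : ∀ y : ι → ℝ, f y = ∑ i, c i * y i := by
    intro y
    conv_lhs => rw [pi_eq_sum_univ' y]
    rw [map_sum]
    refine Finset.sum_congr rfl fun i _ => ?_
    simp [c, mul_comm]
  -- Points weakly above a value vector are limits of points of `C`.
  have hw_nonneg : ∀ w, ∀ y : ι → ℝ, (∀ i, N i w ≤ y i) → 0 ≤ f y := by
    intro w y hy
    have hlim : Tendsto (fun t : ℝ => f (y + t • fun _ => (1 : ℝ))) (𝓝[>] 0) (𝓝 (f y)) := by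
      have : Continuous fun t : ℝ => f (y + t • fun _ => (1 : ℝ)) := by fun_prop
      simpa using (this.tendsto 0).mono_left nhdsWithin_le_nhds
    refine ge_of_tendsto hlim (eventually_nhdsWithin_of_forall fun t ht => (hf _ ?_).le)
    refine (mem_C _).2 ⟨w, fun i => ?_⟩
    have : 0 < t := ht
    have := hy i
    simp
    linarith
  have hc : ∀ i, 0 ≤ c i := fun i =>
    hw_nonneg 0 _ fun j => by
      rw [(hN j).map_zero]
      by_cases hij : j = i
      · subst hij; simp
      · simp [hij]
  have hsum : 0 < ∑ i, c i := by
    have := hf (fun _ => 1) ((mem_C _).2 ⟨0, fun i => by rw [(hN i).map_zero]; exact one_pos⟩)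
    simpa [f_eq] using this
  refine ⟨fun i => c i / ∑ j, c j, fun i => div_nonneg (hc i) hsum.le, ?_, fun w => ?_⟩
  · rw [← Finset.sum_div, div_self hsum.ne']
  · have : ∑ i, c i / (∑ j, c j) * N i w = f (fun i => N i w) / ∑ j, c j := by
      rw [f_eq, Finset.sum_div]
      exact Finset.sum_congr rfl fun i _ => by ring
    rw [this]
    exact div_nonneg (hw_nonneg w _ fun i => le_rfl) hsum.le

/-- The sum rule for subgradients at the origin of sublinear functionals. -/
theorem exists_linearMap_le_sum_smul_eq_zero {N : ι → V → ℝ} (hN : ∀ i, IsSublinear (N i))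
    {c : ι → ℝ} (hc : ∀ i, 0 ≤ c i) (h : ∀ w, 0 ≤ ∑ i, c i * N i w) :
    ∃ f : ι → V →ₗ[ℝ] ℝ, (∀ i x, f i x ≤ N i x) ∧ ∑ i, c i • f i = 0 := by
  classical
  -- On the diagonal of `ι → V` the zero functional lies below the separable majorant; the
  -- coordinates of its extension `G` are the scaled subgradients.
  let D : Submodule ℝ (ι → V) := LinearMap.range (LinearMap.pi fun _ : ι => (LinearMap.id : V →ₗ[ℝ] V))
  obtain ⟨G, hG₀, hG⟩ := exists_extension_of_le_sublinear (⟨D, 0⟩ : (ι → V) →ₗ.[ℝ] ℝ)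
    (fun w => ∑ i, c i * N i (w i))
    (fun a ha x => by
      rw [Finset.mul_sum]
      exact Finset.sum_congr rfl fun i _ => by rw [Pi.smul_apply, (hN i).smul a ha]; ring)
    (fun x y => by
      rw [← Finset.sum_add_distrib]
      refine Finset.sum_le_sum fun i _ => ?_
      rw [← mul_add]
      exact mul_le_mul_of_nonneg_left ((hN i).add_le _ _) (hc i))
    (by
      rintro ⟨_, w, rfl⟩
      exact h w)
  -- Fillers for indices with `c i = 0`, where `G' i` cannot be divided by `c i`.
  choose e he using fun i => (hN i).exists_linearMap_le
  let G' : ι → V →ₗ[ℝ] ℝ := fun i => G ∘ₗ LinearMap.single ℝ (fun _ => V) i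
  have hG' : ∀ i x, G' i x ≤ c i * N i x := by
    intro i x
    refine (hG (Pi.single i x)).trans_eq ?_
    rw [Finset.sum_eq_single i _ (by simp)]
    · simp
    · intro j _ hj
      simp [hj, (hN j).map_zero]
  have hG'_zero : ∀ i, c i = 0 → G' i = 0 := by
    intro i hi
    ext x
    have h₁ := hG' i x
    have h₂ := hG' i (-x)
    rw [hi, zero_mul] at h₁ h₂
    rw [map_neg] at h₂
    exact le_antisymm h₁ (neg_nonpos.1 h₂)
  have hsum : ∑ i, G' i = 0 := by
    ext x
    have h₀ := hG₀ ⟨fun _ => x, x, rfl⟩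
    have h₁ : G (fun _ => x) = ∑ i, G' i x := by
      rw [← Finset.univ_sum_single (fun _ : ι => x), map_sum]
      rfl
    rw [LinearMap.sum_apply, ← h₁]
    exact h₀
  refine ⟨fun i => if c i = 0 then e i else (c i)⁻¹ • G' i, fun i x => ?_, ?_⟩
  · dsimp only
    split_ifs with hi
    · exact he i x
    · have hpos : 0 < c i := (hc i).lt_of_ne' hi
      rw [LinearMap.smul_apply, smul_eq_mul, inv_mul_le_iff₀ hpos]
      exact hG' i x
  · rw [← hsum]
    refine Finset.sum_congr rfl fun i _ => ?_
    dsimp only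
    split_ifs with hi
    · rw [hi, zero_smul, hG'_zero i hi]
    · rw [smul_inv_smul₀ hi]

end Sublinear

/-! ### Calculus of the Clarke derivative -/

section Clarke

variable {n : ℕ} {ψ : EuclideanSpace ℝ (Fin n) → ℝ} {z w : EuclideanSpace ℝ (Fin n)}

theorem tendsto_add_smul_nhds (z w : EuclideanSpace ℝ (Fin n)) :
    Tendsto (fun q : EuclideanSpace ℝ (Fin n) × ℝ => q.1 + q.2 • w) (𝓝 z ×ˢ 𝓝[>] (0 : ℝ))
      (𝓝 z) := by
  have hcont : Continuous fun q : EuclideanSpace ℝ (Fin n) × ℝ => q.1 + q.2 • w := by fun_prop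
  have h := hcont.tendsto (z, 0)
  rw [nhds_prod_eq, zero_smul, add_zero] at h
  exact h.mono_left (Filter.prod_mono le_rfl nhdsWithin_le_nhds)

theorem eventually_snd_pos (z : EuclideanSpace ℝ (Fin n)) :
    ∀ᶠ q : EuclideanSpace ℝ (Fin n) × ℝ in 𝓝 z ×ˢ 𝓝[>] (0 : ℝ), 0 < q.2 :=
  tendsto_snd.eventually self_mem_nhdsWithin

theorem exists_eventually_abs_quotient_le (hψ : LocallyLipschitz ψ)
    (z w : EuclideanSpace ℝ (Fin n)) :
    ∃ B : ℝ, ∀ᶠ q : EuclideanSpace ℝ (Fin n) × ℝ in 𝓝 z ×ˢ 𝓝[>] (0 : ℝ),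
      |(ψ (q.1 + q.2 • w) - ψ q.1) / q.2| ≤ B := by
  obtain ⟨K, t, ht, hK⟩ := hψ z
  refine ⟨K * ‖w‖, ?_⟩
  filter_upwards [(tendsto_add_smul_nhds z w).eventually ht, tendsto_fst.eventually ht,
    eventually_snd_pos z] with q h₁ h₂ hq
  rw [abs_div, abs_of_pos hq, div_le_iff₀ hq]
  have h := hK.dist_le_mul _ h₁ _ h₂
  rw [Real.dist_eq, dist_eq_norm, add_sub_cancel_left, norm_smul, Real.norm_of_nonneg hq.le] at h
  linarith

theorem eventually_quotient_lt (hψ : LocallyLipschitz ψ) {a : ℝ} (h : clarkeDeriv ψ z w < a) :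
    ∀ᶠ q : EuclideanSpace ℝ (Fin n) × ℝ in 𝓝 z ×ˢ 𝓝[>] (0 : ℝ),
      (ψ (q.1 + q.2 • w) - ψ q.1) / q.2 < a := by
  obtain ⟨B, hB⟩ := exists_eventually_abs_quotient_le hψ z w
  exact eventually_lt_of_limsup_lt h
    (isBoundedUnder_of_eventually_le (hB.mono fun q hq => (abs_le.1 hq).2))

theorem clarkeDeriv_le_of_eventually (hψ : LocallyLipschitz ψ) {a : ℝ}
    (h : ∀ᶠ q : EuclideanSpace ℝ (Fin n) × ℝ in 𝓝 z ×ˢ 𝓝[>] (0 : ℝ),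
      (ψ (q.1 + q.2 • w) - ψ q.1) / q.2 ≤ a) : clarkeDeriv ψ z w ≤ a := by
  obtain ⟨B, hB⟩ := exists_eventually_abs_quotient_le hψ z w
  exact limsup_le_of_le
    (isBoundedUnder_of_eventually_ge (hB.mono fun q hq => (abs_le.1 hq).1)).isCoboundedUnder_le h

/-- The quotient along `v + w` splits at the intermediate point `q.1 + q.2 • v`, which is again an
admissible base point since the upper limit lets base points vary. -/
theorem clarkeDeriv_add_le (hψ : LocallyLipschitz ψ) (z v w : EuclideanSpace ℝ (Fin n)) :
    clarkeDeriv ψ z (v + w) ≤ clarkeDeriv ψ z v + clarkeDeriv ψ z w := by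
  refine le_of_forall_pos_le_add fun ε hε => clarkeDeriv_le_of_eventually hψ ?_
  have hv := eventually_quotient_lt hψ (lt_add_of_pos_right (clarkeDeriv ψ z v) (half_pos hε))
  have hw := eventually_quotient_lt hψ (lt_add_of_pos_right (clarkeDeriv ψ z w) (half_pos hε))
  have hshift : Tendsto (fun q : EuclideanSpace ℝ (Fin n) × ℝ => (q.1 + q.2 • v, q.2))
      (𝓝 z ×ˢ 𝓝[>] (0 : ℝ)) (𝓝 z ×ˢ 𝓝[>] (0 : ℝ)) :=
    (tendsto_add_smul_nhds z v).prodMk tendsto_snd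
  filter_upwards [hv, hshift.eventually hw] with q h₁ h₂
  have : (ψ (q.1 + q.2 • (v + w)) - ψ q.1) / q.2 = (ψ (q.1 + q.2 • v) - ψ q.1) / q.2 +
      (ψ (q.1 + q.2 • v + q.2 • w) - ψ (q.1 + q.2 • v)) / q.2 := by
    rw [smul_add, ← add_assoc]
    ring
  rw [this]
  linarith

theorem clarkeDeriv_smul_le (hψ : LocallyLipschitz ψ) (z w : EuclideanSpace ℝ (Fin n)) {c : ℝ}
    (hc : 0 < c) : clarkeDeriv ψ z (c • w) ≤ c * clarkeDeriv ψ z w := by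
  refine le_of_forall_pos_le_add fun ε hε => clarkeDeriv_le_of_eventually hψ ?_
  have hw := eventually_quotient_lt hψ
    (lt_add_of_pos_right (clarkeDeriv ψ z w) (div_pos hε hc))
  have hmul : Tendsto (fun t : ℝ => t * c) (𝓝[>] 0) (𝓝[>] 0) := by
    refine tendsto_nhdsWithin_iff.2 ⟨?_, eventually_nhdsWithin_of_forall fun t ht => mul_pos ht hc⟩
    have : Continuous fun t : ℝ => t * c := by fun_prop
    simpa using (this.tendsto 0).mono_left nhdsWithin_le_nhds
  have hscale : Tendsto (fun q : EuclideanSpace ℝ (Fin n) × ℝ => (q.1, q.2 * c))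
      (𝓝 z ×ˢ 𝓝[>] (0 : ℝ)) (𝓝 z ×ˢ 𝓝[>] (0 : ℝ)) :=
    tendsto_fst.prodMk (hmul.comp tendsto_snd)
  filter_upwards [hscale.eventually hw, eventually_snd_pos z] with q h hq
  have heq : (ψ (q.1 + q.2 • c • w) - ψ q.1) / q.2 =
      c * ((ψ (q.1 + (q.2 * c) • w) - ψ q.1) / (q.2 * c)) := by
    rw [smul_smul]
    field_simp
  rw [heq]
  calc _ ≤ c * (clarkeDeriv ψ z w + ε / c) := mul_le_mul_of_nonneg_left h.le hc.le
    _ = c * clarkeDeriv ψ z w + ε := by field_simp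

theorem isSublinear_clarkeDeriv (hψ : LocallyLipschitz ψ) (z : EuclideanSpace ℝ (Fin n)) :
    IsSublinear (clarkeDeriv ψ z) where
  smul c hc w := by
    refine le_antisymm (clarkeDeriv_smul_le hψ z w hc) ?_
    -- The reverse inequality is the same bound for the factor `c⁻¹`.
    have h := clarkeDeriv_smul_le hψ z (c • w) (inv_pos.2 hc)
    rwa [inv_smul_smul₀ hc.ne', le_inv_mul_iff₀ hc] at h
  add_le v w := clarkeDeriv_add_le hψ z v w

/-- The Riesz representative of a linear functional on `ℝⁿ`. -/
theorem exists_inner_eq (f : EuclideanSpace ℝ (Fin n) →ₗ[ℝ] ℝ) :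
    ∃ v : EuclideanSpace ℝ (Fin n), ∀ w, ⟪v, w⟫ = f w :=
  ⟨(InnerProductSpace.toDual ℝ _).symm (LinearMap.toContinuousLinearMap f), fun w => by simp⟩

theorem clarkeGradient_nonempty (hψ : LocallyLipschitz ψ) (z : EuclideanSpace ℝ (Fin n)) :
    (clarkeGradient ψ z).Nonempty := by
  obtain ⟨f, hf⟩ := (isSublinear_clarkeDeriv hψ z).exists_linearMap_le
  obtain ⟨v, hv⟩ := exists_inner_eq f
  exact ⟨v, fun w => (hv w).trans_le (hf w)⟩

/-- Directions with negative Clarke derivative are descent directions. -/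
theorem eventually_lt_of_clarkeDeriv_neg (hψ : LocallyLipschitz ψ) (h : clarkeDeriv ψ z w < 0) :
    ∀ᶠ t : ℝ in 𝓝[>] 0, ψ (z + t • w) < ψ z := by
  have hz : Tendsto (fun t : ℝ => (z, t)) (𝓝[>] 0) (𝓝 z ×ˢ 𝓝[>] (0 : ℝ)) :=
    tendsto_const_nhds.prodMk tendsto_id
  filter_upwards [hz.eventually (eventually_quotient_lt hψ h), self_mem_nhdsWithin] with t ht htpos
  have := (div_neg_iff.1 ht).resolve_left fun h' => (lt_asymm h'.2 htpos).elim
  linarith [this.1]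

/-- Fritz John multipliers: if `u` minimizes the maximum of finitely many locally Lipschitz
functions and this minimum is zero, then zero is a convex combination of Clarke subgradients of
the functions that vanish at `u`. -/
theorem exists_fritzJohn_multipliers {ι : Type*} [Fintype ι]
    {h : ι → EuclideanSpace ℝ (Fin n) → ℝ} (hh : ∀ i, LocallyLipschitz (h i))
    {u : EuclideanSpace ℝ (Fin n)} (hu : ∀ i, h i u ≤ 0) (hmin : ∀ z, ∃ i, 0 ≤ h i z) :
    ∃ (c : ι → ℝ) (v : ι → EuclideanSpace ℝ (Fin n)), (∀ i, 0 ≤ c i) ∧ ∑ i, c i = 1 ∧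
      (∀ i, c i ≠ 0 → h i u = 0) ∧ (∀ i, v i ∈ clarkeGradient (h i) u) ∧
      ∑ i, c i • v i = 0 := by
  classical
  let A := {i // h i u = 0}
  have : Nonempty A := by
    obtain ⟨i, hi⟩ := hmin u
    exact ⟨i, le_antisymm (hu i) hi⟩
  have hN : ∀ i : A, IsSublinear (clarkeDeriv (h i) u) := fun i => isSublinear_clarkeDeriv (hh i) u
  have hdir : ∀ w, ∃ i : A, 0 ≤ clarkeDeriv (h i) u w := by
    intro w
    by_contra! hneg
    have hev : ∀ᶠ t : ℝ in 𝓝[>] 0, ∀ i, h i (u + t • w) < 0 := by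
      refine eventually_all.2 fun i => ?_
      by_cases hi : h i u = 0
      · filter_upwards [eventually_lt_of_clarkeDeriv_neg (hh i) (hneg ⟨i, hi⟩)] with t ht
        rwa [hi] at ht
      · have hcont : Continuous fun t : ℝ => h i (u + t • w) :=
          (hh i).continuous.comp (by fun_prop)
        have htend := (hcont.tendsto 0).mono_left (nhdsWithin_le_nhds (s := Set.Ioi 0))
        refine htend.eventually_lt_const ?_
        simpa using lt_of_le_of_ne (hu i) hi
    obtain ⟨t, ht⟩ := hev.exists
    obtain ⟨i, hi⟩ := hmin (u + t • w)
    exact (ht i).not_ge hi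
  obtain ⟨c, hc, hsum, hcN⟩ := exists_convex_combination_nonneg hN hdir
  obtain ⟨f, hf, hf₀⟩ := exists_linearMap_le_sum_smul_eq_zero hN hc hcN
  choose v hv using fun i => exists_inner_eq (f i)
  choose e he using fun i => clarkeGradient_nonempty (hh i) u
  have hrange : ∀ i, i ∉ Set.range (Subtype.val : A → ι) → h i u ≠ 0 := by simp
  -- Inactive indices get weight zero and an arbitrary subgradient.
  refine ⟨fun i => if hi : h i u = 0 then c ⟨i, hi⟩ else 0,
    fun i => if hi : h i u = 0 then v ⟨i, hi⟩ else e i, fun i => ?_, ?_, fun i hi => ?_,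
    fun i => ?_, ?_⟩
  · dsimp only
    split_ifs
    exacts [hc _, le_rfl]
  · rw [← hsum]
    exact (Fintype.sum_of_injective Subtype.val Subtype.val_injective _ _
      (fun i hi => by simp [hrange i hi]) (fun i => by simp [i.2])).symm
  · by_contra hne
    simp [hne] at hi
  · dsimp only
    split_ifs with hi
    · exact fun w => (hv _ w).trans_le (hf _ w)
    · exact he i
  · rw [← Fintype.sum_of_injective Subtype.val Subtype.val_injective (fun i => c i • v i) _
      (fun i hi => by simp [hrange i hi]) (fun i => by simp [i.2])]
    refine ext_inner_right ℝ fun w => ?_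
    have := LinearMap.congr_fun hf₀ w
    simpa [sum_inner, inner_smul_left, hv] using this

end Clarke

/-! ### Interval-valued objectives -/

section Objectives

variable {n : ℕ} {f : EuclideanSpace ℝ (Fin n) → NonemptyInterval ℝ}

theorem abs_sub_le_intervalNorm_gHDiff (Q R : NonemptyInterval ℝ) :
    |Q.fst - R.fst| ≤ intervalNorm (gHDiff Q R) ∧ |Q.snd - R.snd| ≤ intervalNorm (gHDiff Q R) := by
  simp only [intervalNorm, gHDiff]
  rcases le_total (Q.fst - R.fst) (Q.snd - R.snd) with h | h
  · rw [min_eq_left h, max_eq_right h]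
    exact ⟨le_max_left _ _, le_max_right _ _⟩
  · rw [min_eq_right h, max_eq_left h]
    exact ⟨le_max_right _ _, le_max_left _ _⟩

theorem locallyLipschitz_of_forall_exists_abs_sub_le {ψ : EuclideanSpace ℝ (Fin n) → ℝ}
    (h : ∀ u₀, ∃ U ∈ 𝓝 u₀, ∃ L : ℝ, 0 < L ∧ ∀ u₁ ∈ U, ∀ u₂ ∈ U, |ψ u₁ - ψ u₂| ≤ L * ‖u₁ - u₂‖) :
    LocallyLipschitz ψ := by
  intro u₀
  obtain ⟨U, hU, L, hL, h⟩ := h u₀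
  refine ⟨L.toNNReal, U, hU, LipschitzOnWith.of_dist_le_mul fun x hx y hy => ?_⟩
  rw [Real.coe_toNNReal _ hL.le, Real.dist_eq, dist_eq_norm]
  exact h x hx y hy

theorem IntervalLocallyLipschitz.center (hf : IntervalLocallyLipschitz f) :
    LocallyLipschitz fun x => center (f x) := by
  refine locallyLipschitz_of_forall_exists_abs_sub_le fun u₀ => ?_
  obtain ⟨U, hU, L, hL, h⟩ := hf u₀
  refine ⟨U, hU, L, hL, fun x hx y hy => ?_⟩
  obtain ⟨h₁, h₂⟩ := abs_sub_le_intervalNorm_gHDiff (f x) (f y)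
  have h₃ := h x hx y hy
  simp only [IntervalOpt.center]
  rw [abs_le] at *
  constructor <;> linarith

theorem IntervalLocallyLipschitz.width (hf : IntervalLocallyLipschitz f) :
    LocallyLipschitz fun x => width (f x) := by
  refine locallyLipschitz_of_forall_exists_abs_sub_le fun u₀ => ?_
  obtain ⟨U, hU, L, hL, h⟩ := hf u₀
  refine ⟨U, hU, L, hL, fun x hx y hy => ?_⟩
  obtain ⟨h₁, h₂⟩ := abs_sub_le_intervalNorm_gHDiff (f x) (f y)
  have h₃ := h x hx y hy
  simp only [IntervalOpt.width]
  rw [abs_le] at *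
  constructor <;> linarith

theorem locallyLipschitz_sub_const {ψ : EuclideanSpace ℝ (Fin n) → ℝ} (hψ : LocallyLipschitz ψ)
    (a : ℝ) : LocallyLipschitz fun x => ψ x - a := by
  intro x
  obtain ⟨K, t, ht, h⟩ := hψ x
  exact ⟨K, t, ht, fun y hy z hz => by simpa [edist_dist, Real.dist_eq] using h hy hz⟩

theorem clarkeGradient_sub_const (ψ : EuclideanSpace ℝ (Fin n) → ℝ) (a : ℝ)
    (z : EuclideanSpace ℝ (Fin n)) :
    clarkeGradient (fun x => ψ x - a) z = clarkeGradient ψ z := by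
  simp [clarkeGradient, clarkeDeriv]

/-- A nonnegative combination of a subgradient of the centre and one of the width is a multiple of
an element of the interval gradient. -/
theorem smul_add_smul_mem_smul_intervalGradient {u v w : EuclideanSpace ℝ (Fin n)}
    (hv : v ∈ clarkeGradient (fun x => center (f x)) u)
    (hw : w ∈ clarkeGradient (fun x => width (f x)) u) {a b : ℝ} (ha : 0 ≤ a) (hb : 0 ≤ b) :
    a • v + b • w ∈ (a + b) • intervalGradient f u := by
  have hv' : v ∈ intervalGradient f u := subset_convexHull ℝ _ (Or.inl hv)
  have hw' : w ∈ intervalGradient f u := subset_convexHull ℝ _ (Or.inr hw)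
  have hconv : Convex ℝ (intervalGradient f u) := convex_convexHull ℝ _
  -- For a convex set, dilation distributes over sums of nonnegative factors.
  rw [hconv.add_smul ha hb]
  exact Set.add_mem_add (Set.smul_mem_smul_set hv') (Set.smul_mem_smul_set hw')

end Objectives

end IntervalOpt

theorem theorem4p2 {n m p : ℕ}
    (F : Fin m → EuclideanSpace ℝ (Fin n) → NonemptyInterval ℝ)
    (g : Fin p → EuclideanSpace ℝ (Fin n) → ℝ)
    (hF : ∀ k, IntervalOpt.IntervalLocallyLipschitz (F k))
    (hg : ∀ j, LocallyLipschitz (g j))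
    (u : EuclideanSpace ℝ (Fin n))
    (hu : IntervalOpt.IsWeakMinimal F (IntervalOpt.feasibleSet g) u)
    (hBCQ : IntervalOpt.BCQ g u) :
    ∃ (lam : Fin m → ℝ) (μ : Fin p → ℝ),
      (∀ k, 0 ≤ lam k) ∧ (∀ j, 0 ≤ μ j) ∧ ∑ k, lam k = 1 ∧
      (0 : EuclideanSpace ℝ (Fin n)) ∈
        ∑ k, lam k • IntervalOpt.intervalGradient (F k) u +
          ∑ j ∈ IntervalOpt.activeSet g u, μ j • IntervalOpt.clarkeGradient (g j) u ∧
      ∀ j, μ j * g j u = 0 := by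
  let h : (Fin m ⊕ Fin m) ⊕ Fin p → EuclideanSpace ℝ (Fin n) → ℝ :=
    Sum.elim (Sum.elim (fun k x => IntervalOpt.center (F k x) - IntervalOpt.center (F k u))
      (fun k x => IntervalOpt.width (F k x) - IntervalOpt.width (F k u))) g
  have hmin : ∀ z, ∃ i, 0 ≤ h i z := by
    intro z
    by_contra! hneg
    exact hu.2 ⟨z, fun j => (hneg (.inr j)).le, fun k =>
      ⟨sub_neg.1 (hneg (.inl (.inl k))), sub_neg.1 (hneg (.inl (.inr k)))⟩⟩
  have hle : ∀ i, h i u ≤ 0 := by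
    rintro ((k | k) | j)
    exacts [(sub_self _).le, (sub_self _).le, hu.1 j]
  have hlip : ∀ i, LocallyLipschitz (h i) := by
    rintro ((k | k) | j)
    exacts [IntervalOpt.locallyLipschitz_sub_const (hF k).center _,
      IntervalOpt.locallyLipschitz_sub_const (hF k).width _, hg j]
  obtain ⟨c, v, hc, hsum, hcomp, hv, hzero⟩ :=
    IntervalOpt.exists_fritzJohn_multipliers hlip hle hmin
  have hv_center : ∀ k, v (.inl (.inl k)) ∈
      IntervalOpt.clarkeGradient (fun x => IntervalOpt.center (F k x)) u := fun k =>
    IntervalOpt.clarkeGradient_sub_const (fun x => IntervalOpt.center (F k x)) _ u ▸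
      hv (.inl (.inl k))
  have hv_width : ∀ k, v (.inl (.inr k)) ∈
      IntervalOpt.clarkeGradient (fun x => IntervalOpt.width (F k x)) u := fun k =>
    IntervalOpt.clarkeGradient_sub_const (fun x => IntervalOpt.width (F k x)) _ u ▸
      hv (.inl (.inr k))
  have hcompl : ∀ j, g j u ≠ 0 → c (.inr j) = 0 := fun j hj => by
    by_contra hne
    exact hj (hcomp _ hne)
  simp only [Fintype.sum_sum_type, ← Finset.sum_add_distrib] at hsum hzero
  let s := ∑ k, (c (.inl (.inl k)) + c (.inl (.inr k)))
  have hs_nonneg : ∀ k ∈ Finset.univ, 0 ≤ c (.inl (.inl k)) + c (.inl (.inr k)) :=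
    fun k _ => add_nonneg (hc _) (hc _)
  -- If the objective weights all vanished, the constraint weights would sum to 1 and violate BCQ.
  have hs : 0 < s := by
    refine (Finset.sum_nonneg hs_nonneg).lt_of_ne' fun hs₀ => hBCQ ⟨fun j => c (.inr j), ?_,
      fun j => hc _, fun j hj => hcompl j (by simpa [IntervalOpt.activeSet] using hj), ?_⟩
    · intro hμ
      have : ∀ j, c (.inr j) = 0 := fun j => congrFun hμ j
      rw [hs₀] at hsum
      simp [this] at hsum
    · have hck := (Finset.sum_eq_zero_iff_of_nonneg hs_nonneg).1 hs₀
      have h₁ : ∀ k, c (.inl (.inl k)) = 0 := fun k => by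
        linarith [hck k (Finset.mem_univ k), hc (.inl (.inl k)), hc (.inl (.inr k))]
      have h₂ : ∀ k, c (.inl (.inr k)) = 0 := fun k => by
        linarith [hck k (Finset.mem_univ k), hc (.inl (.inl k)), hc (.inl (.inr k))]
      simp only [h₁, h₂, zero_smul, add_zero, Finset.sum_const_zero, zero_add] at hzero
      rw [← hzero]
      exact Set.finsetSum_mem_finsetSum _ _ _ fun j _ => Set.smul_mem_smul_set (hv (.inr j))
  refine ⟨fun k => s⁻¹ * c (.inl (.inl k)) + s⁻¹ * c (.inl (.inr k)), fun j => s⁻¹ * c (.inr j),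
    fun k => ?_, fun j => ?_, ?_, ?_, fun j => ?_⟩
  · exact add_nonneg (mul_nonneg (inv_pos.2 hs).le (hc _)) (mul_nonneg (inv_pos.2 hs).le (hc _))
  · exact mul_nonneg (inv_pos.2 hs).le (hc _)
  · simp only [← mul_add, ← Finset.mul_sum]
    exact inv_mul_cancel₀ hs.ne'
  · have hactive : ∑ j ∈ IntervalOpt.activeSet g u, (s⁻¹ * c (.inr j)) • v (.inr j) =
        s⁻¹ • ∑ j, c (.inr j) • v (.inr j) := by
      simp only [Finset.smul_sum, smul_smul]
      refine Finset.sum_subset (Finset.subset_univ _) fun j _ hj => ?_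
      rw [hcompl j (by simpa [IntervalOpt.activeSet] using hj), mul_zero, zero_smul]
    have hobj : ∑ k, ((s⁻¹ * c (.inl (.inl k))) • v (.inl (.inl k)) +
        (s⁻¹ * c (.inl (.inr k))) • v (.inl (.inr k))) =
        s⁻¹ • ∑ k, (c (.inl (.inl k)) • v (.inl (.inl k)) +
          c (.inl (.inr k)) • v (.inl (.inr k))) := by
      simp only [Finset.smul_sum, smul_add, smul_smul]
    refine Set.mem_add.2 ⟨_, Set.finsetSum_mem_finsetSum _ _ _ fun k _ =>
      IntervalOpt.smul_add_smul_mem_smul_intervalGradient (hv_center k) (hv_width k)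
        (mul_nonneg (inv_pos.2 hs).le (hc _)) (mul_nonneg (inv_pos.2 hs).le (hc _)),
      _, Set.finsetSum_mem_finsetSum _ _ _ fun j _ => Set.smul_mem_smul_set (hv (.inr j)), ?_⟩
    rw [hobj, hactive, ← smul_add, hzero, smul_zero]
  · by_cases hj : g j u = 0
    · simp [hj]
    · simp [hcompl j hj]
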